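/- All rings are commutative with identity. An element $a$ of a ring $R$ is *adequate* if for every $b\in R$ there exist $r,s\in R$ such that $a=rs$, $rR+bR=R$, and $s'R+bR\neq R$ for each non-invertible divisor $s'$ of $s$. A ring $R$ is *$\pi$-adequate* if every finitely generated ideal of $R$ is principal and for every nonzero $a\in R$ there exists an integer $n\ge 1$ such that $a^n$ is adequate. A ring $R$ is an *elementary divisor ring* if for every (not necessarily square) matrix $A$ over $R$ there exist invertible matrices $P$ and $Q$ over $R$ such that $PAQ$ is a diagonal matrix $(d_{ij})$ in which $d_{ii}$ divides $d_{i+1,i+1}$ for each $i$. **Corollary 4.9.** Every $\pi$-adequate ring is an elementary divisor ring. -/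

import Mathlib

/-- An element `a` of a commutative ring is adequate: for every `b` there is a factorization
`a = r * s` with `rR + bR = R` such that `s'R + bR ≠ R` for every non-invertible divisor `s'`
of `s`. Here `IsCoprime x y` says that `u * x + v * y = 1` for some `u`, `v`, that is,
`xR + yR = R`. -/
def IsAdequateElement {R : Type*} [CommRing R] (a : R) : Prop :=
  ∀ b : R, ∃ r s : R, a = r * s ∧ IsCoprime r b ∧
    ∀ s' : R, s' ∣ s → ¬ IsUnit s' → ¬ IsCoprime s' b

/-- A `π`-adequate ring: a Bézout ring in which every nonzero element has a positive power
that is adequate. -/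
def IsPiAdequateRing (R : Type*) [CommRing R] : Prop :=
  IsBezout R ∧ ∀ a : R, a ≠ 0 → ∃ n : ℕ, 1 ≤ n ∧ IsAdequateElement (a ^ n)

/-- A (not necessarily square) matrix `D` is diagonal, and each diagonal entry divides the
next one. -/
def IsDivisibilityDiagonal {R : Type*} [CommRing R] {m n : ℕ}
    (D : Matrix (Fin m) (Fin n) R) : Prop :=
  (∀ (i : Fin m) (j : Fin n), (i : ℕ) ≠ (j : ℕ) → D i j = 0) ∧
  ∀ (k : ℕ) (hm : k + 1 < m) (hn : k + 1 < n),
    D ⟨k, Nat.lt_of_succ_lt hm⟩ ⟨k, Nat.lt_of_succ_lt hn⟩ ∣ D ⟨k + 1, hm⟩ ⟨k + 1, hn⟩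

/-- The matrix `A` admits diagonal reduction: `P * A * Q` is diagonal with each diagonal entry
dividing the next one, for some invertible square matrices `P` and `Q`. -/
def AdmitsDiagonalReduction {R : Type*} [CommRing R] {m n : ℕ}
    (A : Matrix (Fin m) (Fin n) R) : Prop :=
  ∃ (P : Matrix (Fin m) (Fin m) R) (Q : Matrix (Fin n) (Fin n) R),
    IsUnit P ∧ IsUnit Q ∧ IsDivisibilityDiagonal (P * A * Q)

/-- An elementary divisor ring: every matrix, of any size, admits diagonal reduction. -/
def IsElementaryDivisorRing (R : Type*) [CommRing R] : Prop :=
  ∀ (m n : ℕ) (A : Matrix (Fin m) (Fin n) R), AdmitsDiagonalReduction A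

/-! ### Stable range conditions and unimodular combinations -/

section Ring

variable {R : Type*} [CommRing R]

/-! Since coprimality to `c` and to a power of `c` agree, adequacy of a power makes every proper
quotient `R/cR`, `c ≠ 0`, have stable range one (`IsPiAdequateRing.exists_isCoprime_add_mul`). Hence
`R` has stable range two, so, being Bézout, it is Hermite: a row reduces to a single entry. The same
property gives Kaplansky's condition for `2 × 2` triangular matrices (`exists_isCoprime_mul_add`).
Absorbing rows one at a time then yields a pivot dividing every entry; clear its row and column and
recurse. -/

/-- In a Bézout ring, if `c` is adequate and `a`, `b`, `c` generate the unit ideal, then some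
`b + t * a` is coprime to `c`. -/
theorem IsAdequateElement.exists_isCoprime_add_mul [IsBezout R] {a b c : R}
    (hc : IsAdequateElement c) (h : Ideal.span {a, b, c} = ⊤) :
    ∃ t, IsCoprime (b + t * a) c := by
  obtain ⟨r, s, rfl, hrb, hs⟩ := hc b
  refine ⟨r, IsCoprime.mul_right ?_ ?_⟩
  · have : IsCoprime b r := hrb.symm
    exact this.add_mul_left_left a
  · have hg : Ideal.span {IsBezout.gcd s (b + r * a)} = Ideal.span {s, b + r * a} :=
      IsBezout.span_gcd _ _
    have hgs := IsBezout.gcd_dvd_left s (b + r * a)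
    obtain ⟨k, hk⟩ := IsBezout.gcd_dvd_right s (b + r * a)
    obtain ⟨l, hl⟩ := hgs
    obtain ⟨u, v, huv⟩ := hrb
    obtain ⟨x, y, z, hxyz⟩ : ∃ x y z, x * a + y * b + z * (r * s) = 1 := by
      have h1 : (1 : R) ∈ Ideal.span {a, b, r * s} := h ▸ Submodule.mem_top
      simp only [Ideal.mem_span_insert, Ideal.mem_span_singleton'] at h1
      obtain ⟨x, _, ⟨y, _, ⟨z, rfl⟩, rfl⟩, h1⟩ := h1
      exact ⟨x, y, z, by linear_combination -h1⟩
    -- Modulo the gcd and `b`, `r * a` vanishes and `r` is a unit, so `a` vanishes, as does `s`;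
    -- unimodularity then makes the gcd coprime to `b`.
    have hu : IsUnit (IsBezout.gcd s (b + r * a)) := by
      by_contra hn
      refine hs _ (Dvd.intro _ hl.symm) hn
        ⟨u * x * k + z * r * l, -(u * x) + x * a * v + y, ?_⟩
      generalize IsBezout.gcd s (b + r * a) = g at *
      linear_combination hxyz + x * a * huv - z * r * hl - u * x * hk
    have h1 : (1 : R) ∈ Ideal.span {s, b + r * a} := by
      rw [← hg, Ideal.span_singleton_eq_top.2 hu]; exact Submodule.mem_top
    obtain ⟨p, q, hpq⟩ := Ideal.mem_span_pair.1 h1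
    exact IsCoprime.symm ⟨p, q, hpq⟩

theorem IsPiAdequateRing.exists_isCoprime_add_mul (hR : IsPiAdequateRing R) {a b c : R}
    (hc : c ≠ 0) (h : Ideal.span {a, b, c} = ⊤) : ∃ t, IsCoprime (b + t * a) c := by
  obtain ⟨hB, hR⟩ := hR
  obtain ⟨n, hn, had⟩ := hR c hc
  have h' : Ideal.span {a, b, c ^ n} = ⊤ := by
    rw [← Ideal.radical_eq_top, eq_top_iff, ← h, Ideal.span_le]
    rintro x (rfl | rfl | rfl)
    · exact Ideal.le_radical (Ideal.subset_span (by simp))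
    · exact Ideal.le_radical (Ideal.subset_span (by simp))
    · exact ⟨n, Ideal.subset_span (by simp)⟩
  obtain ⟨t, ht⟩ := had.exists_isCoprime_add_mul h'
  exact ⟨t, (IsCoprime.pow_right_iff hn).1 ht⟩

theorem IsPiAdequateRing.stableRange_two (hR : IsPiAdequateRing R) {a b c : R}
    (h : Ideal.span {a, b, c} = ⊤) : ∃ u v, IsCoprime (a + c * u) (b + c * v) := by
  by_cases ha : a = 0
  · by_cases hb : b = 0
    · subst ha hb
      have hc : IsUnit c := by
        rw [← Ideal.span_singleton_eq_top, ← h]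
        simp
      obtain ⟨d, hd⟩ := hc.exists_left_inv
      exact ⟨1, 0, d, 0, by linear_combination hd⟩
    · obtain ⟨t, ht⟩ := hR.exists_isCoprime_add_mul (a := c) (b := a) hb
        (by rw [← h]; congr 1; ext; simp; tauto)
      exact ⟨t, 0, by simpa [mul_comm] using ht⟩
  · obtain ⟨t, ht⟩ := hR.exists_isCoprime_add_mul (a := c) (b := b) ha
      (by rw [← h]; congr 1; ext; simp; tauto)
    exact ⟨0, t, by simpa [mul_comm] using ht.symm⟩

theorem IsPiAdequateRing.exists_eq_mul_isCoprime (hR : IsPiAdequateRing R) (a b : R) :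
    ∃ d a' b', a = d * a' ∧ b = d * b' ∧ IsCoprime a' b' := by
  have := hR.1
  obtain ⟨a', ha⟩ := IsBezout.gcd_dvd_left a b
  obtain ⟨b', hb⟩ := IsBezout.gcd_dvd_right a b
  obtain ⟨x, y, hd⟩ := IsBezout.gcd_eq_sum a b
  generalize IsBezout.gcd a b = d at *
  have h0 : d * (1 - (a' * x + b' * y)) = 0 := by
    linear_combination x * ha + y * hb - hd
  -- The third element kills `d`, so adding multiples of it to `a'` and `b'` leaves `d * a'` and `d
  -- * b'` unchanged.
  obtain ⟨u, v, huv⟩ := hR.stableRange_two (a := a') (b := b') (c := 1 - (a' * x + b' * y)) (by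
    rw [Ideal.eq_top_iff_one]
    simp only [Ideal.mem_span_insert, Ideal.mem_span_singleton']
    exact ⟨x, _, ⟨y, _, ⟨1, rfl⟩, rfl⟩, by ring⟩)
  exact ⟨d, _, _, by linear_combination ha - u * h0, by linear_combination hb - v * h0, huv⟩

theorem IsPiAdequateRing.exists_isCoprime_mul_add (hR : IsPiAdequateRing R) {a b c : R}
    (h : Ideal.span {a, b, c} = ⊤) : ∃ p q, IsCoprime (p * a + q * b) (q * c) := by
  by_cases hc : c = 0
  · subst hc
    have h1 : (1 : R) ∈ Ideal.span {a, b, 0} := h ▸ Submodule.mem_top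
    simp only [Ideal.mem_span_insert, Ideal.mem_span_singleton'] at h1
    obtain ⟨p, _, ⟨q, _, ⟨z, rfl⟩, rfl⟩, h1⟩ := h1
    exact ⟨p, q, 1, 0, by linear_combination -h1⟩
  · obtain ⟨t, ht⟩ := hR.exists_isCoprime_add_mul hc h
    exact ⟨t, 1, by simpa [add_comm] using ht⟩

/-- The rows of the matrix with rows `(d, 0)` and `(x, y)` have a unimodular combination whose
content is that of the whole matrix. -/
theorem IsPiAdequateRing.exists_combination (hR : IsPiAdequateRing R) (d x y : R) :
    ∃ p q, IsCoprime p q ∧ ∀ e, e ∣ p * d + q * x → e ∣ q * y → e ∣ d ∧ e ∣ x ∧ e ∣ y := by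
  obtain ⟨g, d₁, x₁, rfl, rfl, u, v, huv⟩ := hR.exists_eq_mul_isCoprime d x
  obtain ⟨f, g₁, y₁, rfl, rfl, k, l, hkl⟩ := hR.exists_eq_mul_isCoprime g y
  obtain ⟨p, q, z, w, hzw⟩ := hR.exists_isCoprime_mul_add
    (a := g₁ * d₁) (b := g₁ * x₁) (c := y₁) (by
      rw [Ideal.eq_top_iff_one]
      simp only [Ideal.mem_span_insert, Ideal.mem_span_singleton']
      exact ⟨k * u, _, ⟨k * v, _, ⟨l, rfl⟩, rfl⟩, by
        linear_combination -hkl - k * g₁ * huv⟩)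
  refine ⟨p, q, ⟨z * g₁ * d₁, z * g₁ * x₁ + w * y₁, by linear_combination hzw⟩, fun e h₁ h₂ => ?_⟩
  have hf : e ∣ f := by
    have : f = z * (p * (f * g₁ * d₁) + q * (f * g₁ * x₁)) + w * (q * (f * y₁)) := by
      linear_combination -f * hzw
    rw [this]
    exact dvd_add (h₁.mul_left _) (h₂.mul_left _)
  exact ⟨(hf.mul_right _).mul_right _, (hf.mul_right _).mul_right _, hf.mul_right _⟩

end Ring

/-! ### Elementary automorphisms and Hermite reduction of a row -/

section LinearEquivs

variable {R : Type*} [CommRing R] {κ : Type*}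

theorem LinearMap.dvd_apply_of_forall_dvd {κ' : Type*} (f : (κ → R) →ₗ[R] (κ' → R))
    {e : R} {x : κ → R} (h : ∀ j, e ∣ x j) (k : κ') : e ∣ f x k := by
  choose y hy using h
  have : x = e • y := funext hy
  rw [this, map_smul]
  exact Dvd.intro _ rfl

/-- The automorphism `y ↦ y - y i • c` of `κ → R`, where `c i = 0`. -/
def clearLinearEquiv (i : κ) (c : κ → R) (hc : c i = 0) : (κ → R) ≃ₗ[R] (κ → R) where
  toFun y := y - y i • c
  invFun y := y + y i • c
  map_add' y z := by ext k; simp; ring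
  map_smul' r y := by ext k; simp; ring
  left_inv y := by ext k; simp [hc]
  right_inv y := by ext k; simp [hc]

theorem clearLinearEquiv_apply (i : κ) (c : κ → R) (hc : c i = 0) (y : κ → R) (k : κ) :
    clearLinearEquiv i c hc y k = y k - y i * c k := rfl

variable [DecidableEq κ]

/-- The automorphism of `κ → R` given by a `2 × 2` matrix of determinant one acting on the
coordinates `i` and `j`. -/
def pairLinearEquiv {i j : κ} (hij : i ≠ j) (a b c d : R) (h : a * d - b * c = 1) :
    (κ → R) ≃ₗ[R] (κ → R) where
  toFun y k := if k = i then a * y i + b * y j else if k = j then c * y i + d * y j else y k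
  invFun y k := if k = i then d * y i - b * y j else if k = j then a * y j - c * y i else y k
  map_add' y z := by ext k; simp only [Pi.add_apply]; split_ifs <;> ring
  map_smul' r y := by
    ext k; simp only [Pi.smul_apply, smul_eq_mul, RingHom.id_apply]; split_ifs <;> ring
  left_inv y := by
    ext k
    by_cases h₁ : k = i
    · subst h₁; simp only [hij.symm, if_true, if_false]; linear_combination y k * h
    · by_cases h₂ : k = j
      · subst h₂; simp only [hij.symm, if_true, if_false]; linear_combination y k * h
      · simp [h₁, h₂]
  right_inv y := by
    ext k
    by_cases h₁ : k = i
    · subst h₁; simp only [hij.symm, if_true, if_false]; linear_combination y k * h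
    · by_cases h₂ : k = j
      · subst h₂; simp only [hij.symm, if_true, if_false]; linear_combination y k * h
      · simp [h₁, h₂]

theorem pairLinearEquiv_apply {i j : κ} (hij : i ≠ j) (a b c d : R) (h : a * d - b * c = 1)
    (y : κ → R) (k : κ) : pairLinearEquiv hij a b c d h y k =
      if k = i then a * y i + b * y j else if k = j then c * y i + d * y j else y k := rfl

theorem IsPiAdequateRing.exists_linearEquiv_eq_zero (hR : IsPiAdequateRing R) [Fintype κ]
    (j₀ : κ) (x : κ → R) : ∃ f : (κ → R) ≃ₗ[R] (κ → R), ∀ j, j ≠ j₀ → f x j = 0 := by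
  suffices H : ∀ s : Finset κ, j₀ ∉ s → ∃ f : (κ → R) ≃ₗ[R] (κ → R), ∀ j ∈ s, f x j = 0 by
    obtain ⟨f, hf⟩ := H (Finset.univ.erase j₀) (by simp)
    exact ⟨f, fun j hj => hf j (by simp [hj])⟩
  intro s
  induction s using Finset.induction_on with
  | empty => exact fun _ => ⟨.refl R _, by simp⟩
  | insert k s hk ih =>
    intro hj
    rw [Finset.mem_insert, not_or] at hj
    obtain ⟨f, hf⟩ := ih hj.2
    obtain ⟨d, a, b, ha, hb, u, v, huv⟩ := hR.exists_eq_mul_isCoprime (f x j₀) (f x k)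
    -- The matrix with rows `(u, v)` and `(-b, a)` sends `(d * a, d * b)` to `(d, 0)`.
    refine ⟨f.trans (pairLinearEquiv hj.1 u v (-b) a (by linear_combination huv)), ?_⟩
    intro j hjs
    rw [LinearEquiv.trans_apply, pairLinearEquiv_apply]
    rcases Finset.mem_insert.1 hjs with rfl | hjs
    · rw [if_neg (Ne.symm hj.1), if_pos rfl, ha, hb]; ring
    · rw [if_neg (ne_of_mem_of_not_mem hjs hj.2), if_neg (ne_of_mem_of_not_mem hjs hk), hf j hjs]

end LinearEquivs

/-! ### Equivalence of matrices and diagonal reduction -/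

namespace Matrix

variable {R : Type*} [CommRing R] {ι κ : Type*} [Fintype ι] [DecidableEq ι]
  [Fintype κ] [DecidableEq κ]

/-- Two matrices are equivalent if they differ by invertible factors on both sides. -/
def IsEquiv (A B : Matrix ι κ R) : Prop :=
  ∃ (P : Matrix ι ι R) (Q : Matrix κ κ R), IsUnit P ∧ IsUnit Q ∧ P * A * Q = B

theorem IsEquiv.refl (A : Matrix ι κ R) : IsEquiv A A :=
  ⟨1, 1, isUnit_one, isUnit_one, by simp⟩

theorem IsEquiv.trans {A B C : Matrix ι κ R} (h : IsEquiv A B) (h' : IsEquiv B C) :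
    IsEquiv A C := by
  obtain ⟨P, Q, hP, hQ, rfl⟩ := h
  obtain ⟨P', Q', hP', hQ', rfl⟩ := h'
  exact ⟨P' * P, Q * Q', hP'.mul hP, hQ.mul hQ', by simp only [Matrix.mul_assoc]⟩

theorem IsEquiv.transpose {A B : Matrix ι κ R} (h : IsEquiv A B) : IsEquiv Aᵀ Bᵀ := by
  obtain ⟨P, Q, hP, hQ, rfl⟩ := h
  exact ⟨Qᵀ, Pᵀ, (isUnit_transpose Q).2 hQ, (isUnit_transpose P).2 hP,
    by simp [Matrix.mul_assoc]⟩

theorem IsEquiv.of_map_rows (A : Matrix ι κ R) (f : (κ → R) ≃ₗ[R] (κ → R)) :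
    IsEquiv A (of fun i => f (A i)) := by
  have hu : IsUnit (LinearMap.toMatrixRight' f.toLinearMap) := by
    refine IsUnit.of_mul_eq_one (LinearMap.toMatrixRight' f.symm.toLinearMap) ?_
    apply LinearMap.toMatrixRight'.symm.injective
    change toLinearMapRight' _ = toLinearMapRight' _
    rw [toLinearMapRight'_mul, toLinearMapRight'_one]
    ext x
    simp
  refine ⟨1, _, isUnit_one, hu, ?_⟩
  rw [Matrix.one_mul]
  ext i j
  have h : A i ᵥ* LinearMap.toMatrixRight' f.toLinearMap = f (A i) :=
    LinearMap.congr_fun (toLinearMapRight'.apply_symm_apply f.toLinearMap) (A i)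
  exact congr_fun h j

theorem IsEquiv.of_map_cols (A : Matrix ι κ R) (f : (ι → R) ≃ₗ[R] (ι → R)) :
    IsEquiv A (of fun i j => f (fun k => A k j) i) :=
  (IsEquiv.of_map_rows Aᵀ f).transpose

theorem IsEquiv.dvd {A B : Matrix ι κ R} (h : IsEquiv A B) {e : R} (he : ∀ i j, e ∣ A i j)
    (i : ι) (j : κ) : e ∣ B i j := by
  obtain ⟨P, Q, -, -, rfl⟩ := h
  simp only [mul_apply]
  exact Finset.dvd_sum fun k _ => (Finset.dvd_sum fun l _ => (he l k).mul_left _).mul_right _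

/-- If an entry divides its row, the rest of that row can be cleared; the entry and its
divisibility of other rows are kept. -/
theorem exists_isEquiv_row_eq_zero (A : Matrix ι κ R) (i₀ : ι) (j₀ : κ)
    (h : ∀ j, A i₀ j₀ ∣ A i₀ j) :
    ∃ B, IsEquiv A B ∧ B i₀ j₀ = A i₀ j₀ ∧ (∀ j, j ≠ j₀ → B i₀ j = 0) ∧
      (∀ i, B i j₀ = A i j₀) ∧
      ∀ i, (∀ j, A i₀ j₀ ∣ A i j) → ∀ j, A i₀ j₀ ∣ B i j := by
  choose c hc using h
  have hc' : Function.update c j₀ 0 j₀ = 0 := by simp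
  refine ⟨_, IsEquiv.of_map_rows A (clearLinearEquiv j₀ (Function.update c j₀ 0) hc'), ?_,
    fun j hj => ?_, fun i => ?_, fun i hi j => ?_⟩
  · simp [clearLinearEquiv_apply]
  · rw [of_apply, clearLinearEquiv_apply, Function.update_of_ne hj, ← hc j, sub_self]
  · simp [clearLinearEquiv_apply]
  · exact dvd_sub (hi j) ((hi j₀).mul_right _)

theorem exists_isEquiv_forall_dvd (hR : IsPiAdequateRing R) (A : Matrix ι κ R)
    (i₀ : ι) (j₀ : κ) : ∃ B, IsEquiv A B ∧ ∀ i j, B i₀ j₀ ∣ B i j := by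
  suffices H : ∀ s : Finset ι, i₀ ∉ s →
      ∃ B, IsEquiv A B ∧ ∀ i ∈ insert i₀ s, ∀ j, B i₀ j₀ ∣ B i j by
    obtain ⟨B, hB, h⟩ := H (Finset.univ.erase i₀) (by simp)
    exact ⟨B, hB, fun i j => h i (by simp [Finset.insert_erase]) j⟩
  intro s
  induction s using Finset.induction_on with
  | empty =>
    intro _
    obtain ⟨f, hf⟩ := hR.exists_linearEquiv_eq_zero j₀ (A i₀)
    refine ⟨_, IsEquiv.of_map_rows A f, fun i hi j => ?_⟩
    obtain rfl : i = i₀ := by simpa using hi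
    by_cases hj : j = j₀
    · rw [hj]
    · rw [of_apply, of_apply, hf j hj]; exact dvd_zero _
  | insert i₁ s hi₁ ih =>
    intro hi
    rw [Finset.mem_insert, not_or] at hi
    obtain ⟨B₀, hAB₀, hB₀⟩ := ih hi.2
    obtain ⟨B, hB₀B, hd, hz, -, hdvd⟩ := exists_isEquiv_row_eq_zero B₀ i₀ j₀
      (hB₀ i₀ (Finset.mem_insert_self _ _))
    have hB : ∀ i ∈ insert i₀ s, ∀ j, B i₀ j₀ ∣ B i j := fun i hi j =>
      hd ▸ hdvd i (hB₀ i hi) j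
    -- With `y` standing for all off-pivot entries of the new row, the two rows behave like the rows
    -- `(d, 0)` and `(x, y)`.
    obtain ⟨y, hy⟩ : ∃ y, Ideal.span (B i₁ '' {j | j ≠ j₀}) = Ideal.span {y} := by
      have := hR.1
      have := IsBezout.isPrincipal_of_FG (Ideal.span (B i₁ '' {j | j ≠ j₀}))
        (Submodule.fg_span (Set.toFinite _))
      exact this.principal
    have hyB : ∀ j, j ≠ j₀ → y ∣ B i₁ j := fun j hj =>
      Ideal.mem_span_singleton.1 (hy ▸ Ideal.subset_span (Set.mem_image_of_mem _ hj))
    obtain ⟨p, q, ⟨u, v, huv⟩, hpq⟩ := hR.exists_combination (B i₀ j₀) (B i₁ j₀) y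
    let g := pairLinearEquiv hi.1 p q (-v) u (by linear_combination huv)
    let C : Matrix ι κ R := of fun i j => g (fun k => B k j) i
    have hBC : IsEquiv B C := IsEquiv.of_map_cols B g
    have hC₀ : ∀ j, C i₀ j = p * B i₀ j + q * B i₁ j := fun j => if_pos rfl
    obtain ⟨f, hf⟩ := hR.exists_linearEquiv_eq_zero j₀ (C i₀)
    refine ⟨_, ((hAB₀.trans hB₀B).trans hBC).trans (IsEquiv.of_map_rows C f), ?_⟩
    simp only [of_apply]
    -- The new pivot generates the content of the combined row, which is that of both rows; in
    -- particular it divides the old pivot, hence all rows already absorbed.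
    set e := f (C i₀) j₀
    have hefC : ∀ j, e ∣ f (C i₀) j := fun j => by
      by_cases hj : j = j₀
      · rw [hj]
      · rw [hf j hj]; exact dvd_zero _
    have heC : ∀ j, e ∣ C i₀ j := fun j => by
      have := f.symm.toLinearMap.dvd_apply_of_forall_dvd hefC j
      simpa using this
    have hqy : e ∣ q * y := by
      have hle : Ideal.span (B i₁ '' {j | j ≠ j₀}) ≤
          Submodule.comap (LinearMap.mulLeft R q) (Ideal.span {e}) := by
        rw [Ideal.span, Submodule.span_le]
        rintro _ ⟨j, hj, rfl⟩
        have := heC j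
        rw [hC₀, hz j hj, mul_zero, zero_add] at this
        exact Ideal.mem_span_singleton.2 this
      exact Ideal.mem_span_singleton.1 (hle (hy ▸ Ideal.mem_span_singleton_self y))
    obtain ⟨h₁, h₂, h₃⟩ := hpq e (hC₀ j₀ ▸ heC j₀) hqy
    have heB₁ : ∀ j, e ∣ B i₁ j := fun j => by
      by_cases hj : j = j₀
      · exact hj ▸ h₂
      · exact h₃.trans (hyB j hj)
    have heB₀ : ∀ j, e ∣ B i₀ j := fun j => h₁.trans (hB i₀ (Finset.mem_insert_self _ _) j)
    intro i hi' j
    refine f.toLinearMap.dvd_apply_of_forall_dvd (fun k => ?_) j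
    change e ∣ pairLinearEquiv hi.1 p q (-v) u (by linear_combination huv) (fun l => B l k) i
    rw [pairLinearEquiv_apply]
    split_ifs with hi₀ hi₁'
    · exact dvd_add ((heB₀ k).mul_left _) ((heB₁ k).mul_left _)
    · exact dvd_add ((heB₀ k).mul_left _) ((heB₁ k).mul_left _)
    · refine h₁.trans (hB i ?_ k)
      simp only [Finset.mem_insert] at hi' ⊢
      tauto

theorem exists_isEquiv_clear (hR : IsPiAdequateRing R) (A : Matrix ι κ R)
    (i₀ : ι) (j₀ : κ) : ∃ B, IsEquiv A B ∧ (∀ i j, B i₀ j₀ ∣ B i j) ∧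
      (∀ j, j ≠ j₀ → B i₀ j = 0) ∧ ∀ i, i ≠ i₀ → B i j₀ = 0 := by
  obtain ⟨B, hAB, hB⟩ := exists_isEquiv_forall_dvd hR A i₀ j₀
  obtain ⟨C, hBC, hC, hC₀, -, hCd⟩ := exists_isEquiv_row_eq_zero B i₀ j₀ (hB i₀)
  have hCdvd : ∀ i j, C i₀ j₀ ∣ C i j := fun i j => hC ▸ hCd i (hB i) j
  obtain ⟨D, hCD, hD, hD₀, hDc, hDd⟩ := exists_isEquiv_row_eq_zero Cᵀ j₀ i₀
    (fun i => hCdvd i j₀)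
  -- Clearing the pivot column leaves the pivot row, already cleared, untouched.
  refine ⟨Dᵀ, (hAB.trans hBC).trans hCD.transpose, fun i j => ?_, fun j hj => ?_, hD₀⟩
  · change D j₀ i₀ ∣ D j i
    rw [hD]
    exact hDd j (fun i => hCdvd i j) i
  · exact (hDc j).trans (hC₀ j hj)

/-- The block diagonal matrix with blocks the scalar `a` and the matrix `A`. -/
def bordered {m n : ℕ} (a : R) (A : Matrix (Fin m) (Fin n) R) :
    Matrix (Fin (m + 1)) (Fin (n + 1)) R :=
  of fun i j => Fin.cases (Fin.cases a (fun _ => 0) j) (fun i => Fin.cases 0 (fun j => A i j) j) i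

theorem bordered_mul {l m n : ℕ} (a b : R) (A : Matrix (Fin l) (Fin m) R)
    (B : Matrix (Fin m) (Fin n) R) :
    bordered a A * bordered b B = bordered (a * b) (A * B) := by
  ext i j
  refine Fin.cases ?_ (fun i => ?_) i <;> refine Fin.cases ?_ (fun j => ?_) j <;>
    simp [bordered, mul_apply, Fin.sum_univ_succ]

theorem bordered_one {n : ℕ} : bordered (1 : R) (1 : Matrix (Fin n) (Fin n) R) = 1 := by
  ext i j
  refine Fin.cases ?_ (fun i => ?_) i <;> refine Fin.cases ?_ (fun j => ?_) j <;>
    simp [bordered, one_apply, Fin.ext_iff]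

theorem isUnit_bordered {n : ℕ} {P : Matrix (Fin n) (Fin n) R} (hP : IsUnit P) :
    IsUnit (bordered 1 P) := by
  obtain ⟨Q, hQ⟩ := hP.exists_right_inv
  exact IsUnit.of_mul_eq_one (bordered 1 Q) (by rw [bordered_mul, hQ, one_mul, bordered_one])

theorem IsEquiv.bordered {m n : ℕ} {A B : Matrix (Fin m) (Fin n) R} (h : IsEquiv A B) (d : R) :
    IsEquiv (bordered d A) (bordered d B) := by
  obtain ⟨P, Q, hP, hQ, rfl⟩ := h
  exact ⟨_, _, isUnit_bordered hP, isUnit_bordered hQ, by simp [bordered_mul]⟩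

theorem isDivisibilityDiagonal_bordered {m n : ℕ} {D : Matrix (Fin m) (Fin n) R}
    (hD : IsDivisibilityDiagonal D) {d : R} (h : ∀ i j, d ∣ D i j) :
    IsDivisibilityDiagonal (bordered d D) := by
  refine ⟨fun i j => ?_, fun k hm hn => ?_⟩
  · refine Fin.cases ?_ (fun i => ?_) i <;> refine Fin.cases ?_ (fun j => ?_) j <;> intro hij
    · exact absurd rfl hij
    · rfl
    · rfl
    · exact hD.1 i j (by simpa using hij)
  · cases k with
    | zero => exact h ⟨0, by omega⟩ ⟨0, by omega⟩
    | succ k => exact hD.2 k (by omega) (by omega)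

theorem exists_isEquiv_isDivisibilityDiagonal (hR : IsPiAdequateRing R) :
    ∀ {m n : ℕ} (A : Matrix (Fin m) (Fin n) R), ∃ D, IsEquiv A D ∧ IsDivisibilityDiagonal D
  | 0, _, A => ⟨A, .refl A, fun i => i.elim0, fun _ hm => absurd hm (by omega)⟩
  | _ + 1, 0, A => ⟨A, .refl A, fun _ j => j.elim0, fun _ _ hn => absurd hn (by omega)⟩
  | m + 1, n + 1, A => by
    obtain ⟨B, hAB, hB, hr, hc⟩ := exists_isEquiv_clear hR A 0 0
    obtain ⟨D, hD, hDd⟩ := exists_isEquiv_isDivisibilityDiagonal hR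
      (of fun (i : Fin m) (j : Fin n) => B i.succ j.succ)
    -- Equivalence preserves common divisors of the entries, so the pivot still divides the
    -- diagonalized block.
    refine ⟨_, hAB.trans ?_, isDivisibilityDiagonal_bordered hDd
      (hD.dvd fun i j => hB i.succ j.succ)⟩
    convert hD.bordered (B 0 0)
    ext i j
    refine Fin.cases ?_ (fun i => ?_) i <;> refine Fin.cases ?_ (fun j => ?_) j
    · rfl
    · exact hr _ (Fin.succ_ne_zero j)
    · exact hc _ (Fin.succ_ne_zero i)
    · rfl

end Matrix

theorem corollary4p9 (R : Type*) [CommRing R] (hR : IsPiAdequateRing R) :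
    IsElementaryDivisorRing R := by
  intro m n A
  obtain ⟨_, ⟨P, Q, hP, hQ, rfl⟩, hD⟩ := Matrix.exists_isEquiv_isDivisibilityDiagonal hR A
  exact ⟨P, Q, hP, hQ, hD⟩
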